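/- Let $k\ge 1$ be an integer and let $K$ be a field. For $n\ge k$ let $\langle n\rangle^k$ be the set of $k$-tuples $u=(u_1,\dots,u_k)$ of pairwise distinct elements of $\{1,\dots,n\}$, and let $R_n=K[x_u : u\in\langle n\rangle^k]$, so that $R_k\subseteq R_{k+1}\subseteq\cdots$. The symmetric group $\mathfrak S_n$ acts on $R_n$ by $K$-algebra automorphisms with $\sigma x_{(u_1,\dots,u_k)}=x_{(\sigma(u_1),\dots,\sigma(u_k))}$. For $m\ge n\ge k$ and $B\subseteq R_n$ let $L_m(B)$ be the ideal of $R_m$ generated by all $\sigma g$ with $\sigma\in\mathfrak S_m$ and $g\in B$. A symmetrization invariant chain is a sequence of ideals $I_n\subseteq R_n$ ($n\ge k$) with $I_k\subseteq I_{k+1}\subseteq\cdots$ and $L_m(I_n)\subseteq I_m$ for all $m\ge n\ge k$. Such a chain stabilizes modulo the symmetric group if there is a positive integer $N$ such that $L_m(I_n)=I_m$ for all $m\ge n>N$ with $n\ge k$; such an $N$ is called a bound for stabilization. **Theorem.** Let $f\in K[y_1,\dots,y_k]$ be a square-free monomial (with coefficient $1$; the indeterminates $y_i$ need not all occur in $f$).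 For $n\ge k$ let $Q_n$ be the kernel of the $K$-algebra homomorphism $$\phi_n\colon R_n\to K[t_1,\dots,t_n],\qquad x_{(u_1,\dots,u_k)}\mapsto f(t_{u_1},\dots,t_{u_k}).$$ Then $Q_k\subseteq Q_{k+1}\subseteq\cdots$ is a symmetrization invariant chain which stabilizes modulo the symmetric group, and $N=4k$ is a bound for stabilization, that is, $L_m(Q_n)=Q_m$ for all $m\ge n>4k$. -/

import Mathlib

namespace SymChain

open MvPolynomial

universe u

/-- The ring `R_n = K[x_u : u ∈ ⟨n⟩^k]`. An ordered `k`-element subset of `{1, …, n}` (a `k`-tuple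
of pairwise distinct elements) is an injection `Fin k ↪ Fin n`. -/
abbrev R (K : Type u) [Field K] (k n : ℕ) : Type u :=
  MvPolynomial (Fin k ↪ Fin n) K

variable {K : Type u} [Field K] {k : ℕ}

/-- The action of `σ ∈ 𝔖_n` on `R_n`, the `K`-algebra map with `σ x_u = x_{σ u}`, where
`σ (u_1, …, u_k) = (σ u_1, …, σ u_k)`. -/
noncomputable def perm {n : ℕ} (σ : Equiv.Perm (Fin n)) : R K k n →ₐ[K] R K k n :=
  rename fun u : Fin k ↪ Fin n => u.trans σ.toEmbedding

/-- The inclusion `R_n ⊆ R_m` for `n ≤ m`, induced by `{1, …, n} ⊆ {1, …, m}`. -/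
noncomputable def incl {n m : ℕ} (h : n ≤ m) : R K k n →ₐ[K] R K k m :=
  rename fun u : Fin k ↪ Fin n => u.trans (Fin.castLEEmb h)

/-- The `m`-symmetrization `L_m(B)` of a set `B ⊆ R_n`, `n ≤ m`: the `R_m[𝔖_m]`-submodule of
`R_m` generated by `B`, that is, the set of all finite sums `∑ f_j • σ_j g_j` with `f_j ∈ R_m`,
`σ_j ∈ 𝔖_m`, `g_j ∈ B`. -/
noncomputable def symmetrization {n m : ℕ} (h : n ≤ m) (B : Set (R K k n)) : Ideal (R K k m) :=
  Ideal.span {p | ∃ σ : Equiv.Perm (Fin m), ∃ g ∈ B, p = perm σ (incl h g)}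

/-- `I_k ⊆ I_{k+1} ⊆ ⋯` is an increasing chain of ideals `I_n ⊆ R_n` (`n ≥ k`) with
`L_m(I_n) ⊆ I_m` for all `m ≥ n`. The values `I n` for `n < k` play no role. -/
structure IsSymmetrizationInvariantChain (I : ∀ n : ℕ, Ideal (R K k n)) : Prop where
  increasing : ∀ n m : ℕ, k ≤ n → ∀ h : n ≤ m, ∀ g ∈ I n, incl h g ∈ I m
  symmetrization_le : ∀ n m : ℕ, k ≤ n → ∀ h : n ≤ m,
    symmetrization h (I n : Set (R K k n)) ≤ I m

/-- `N` is a bound for stabilization modulo the symmetric group of the symmetrization invariant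
chain `I`: `N` is positive and `L_m(I_n) = I_m` for all `m ≥ n > N`. -/
structure StabilizesWithBound (I : ∀ n : ℕ, Ideal (R K k n)) (N : ℕ) : Prop where
  chain : IsSymmetrizationInvariantChain I
  pos : 0 < N
  eq : ∀ n m : ℕ, k ≤ n → N < n → ∀ h : n ≤ m,
    symmetrization h (I n : Set (R K k n)) = I m

/-- The chain `I` stabilizes modulo the symmetric group. -/
def Stabilizes (I : ∀ n : ℕ, Ideal (R K k n)) : Prop :=
  ∃ N : ℕ, StabilizesWithBound I N

/-- The `K`-algebra homomorphism `φ_n : R_n → K[t_1, …, t_n]` with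
`x_{(u_1, …, u_k)} ↦ f(t_{u_1}, …, t_{u_k})`. -/
noncomputable def phi (f : MvPolynomial (Fin k) K) (n : ℕ) :
    R K k n →ₐ[K] MvPolynomial (Fin n) K :=
  aeval fun u : Fin k ↪ Fin n => aeval (fun i : Fin k => (X (u i) : MvPolynomial (Fin n) K)) f

/-- `Q_n`, the kernel of `φ_n`. -/
noncomputable def kernelIdeal (f : MvPolynomial (Fin k) K) (n : ℕ) : Ideal (R K k n) :=
  RingHom.ker (phi f n)

/-- `f` is a square-free monomial: a product of powers of indeterminates, with coefficient `1`,
which is not divisible by the square of a nonunit. -/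
def IsSquarefreeMonomial (f : MvPolynomial (Fin k) K) : Prop :=
  (∃ a : Fin k →₀ ℕ, f = monomial a 1) ∧ Squarefree f

end SymChain

namespace SymChain

open MvPolynomial

/-! ### Exchange moves between families of equicardinal sets. -/

section Exchange

variable {ι τ C : Type*} [CommMonoid C]

/-! Write `f` as the product of the `y_i` with `i ∈ S`. Then `φ_m` sends `x_u` to the product of
`t_a` over `a ∈ u(S)`, so the image of a monomial records exactly the multiset sum of the sets
`u(S)`. Since `φ_m` maps monomials to monomials, `Q_m` is controlled by pairs of monomials with the
same sum.

Any two such monomials are joined by moves involving at most two variables on each side, chiefly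
exchanges of `a ∈ u(S)` with `b ∈ v(S)` (`prod_map_eq_of_sum_eq`). Each move is a binomial in `Q_m`
with at most four variables, hence at most `4k` indices. For `n ≥ 4k` a permutation carries these
indices into `{1, …, n}`, so the binomial lies in `L_m(Q_n)` (`prod_mk_eq_of_card_le_two`). -/

theorem count_sum_val [DecidableEq τ] (A : ι → Finset τ) (U : Multiset ι) (a : τ) :
    (U.map fun u => (A u).val).sum.count a = U.countP fun u => a ∈ A u := by
  induction U using Multiset.induction_on with
  | empty => simp
  | cons u U ih =>
    simp only [Multiset.map_cons, Multiset.sum_cons, Multiset.count_add, ih, Multiset.countP_cons,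
      Multiset.count_eq_of_nodup (A u).nodup, Finset.mem_val]
    omega

theorem prod_map_eq_one_of_sum_eq_zero {A : ι → Finset τ} {g : ι → C}
    (hone : ∀ u, A u = ∅ → g u = 1) {U : Multiset ι}
    (h : (U.map fun u => (A u).val).sum = 0) : (U.map g).prod = 1 := by
  refine Multiset.prod_eq_one fun x hx => ?_
  obtain ⟨u, hu, rfl⟩ := Multiset.mem_map.1 hx
  refine hone u (Finset.val_eq_zero.1 ?_)
  exact Multiset.sum_eq_zero_iff.1 h _ (Multiset.mem_map_of_mem _ hu)

/-- If `a ∈ A u` occurs at most as often as `b ∉ A u` in the family `u ::ₘ U`, then some other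
member of the family contains `b` but not `a`. -/
theorem exists_mem_exchange [DecidableEq τ] {A : ι → Finset τ} {u : ι} {U : Multiset ι} {a b : τ}
    (ha : a ∈ A u) (hb : b ∉ A u)
    (hab : (((u ::ₘ U).map fun u => (A u).val).sum).count a ≤
      (((u ::ₘ U).map fun u => (A u).val).sum).count b) :
    ∃ w ∈ U, b ∈ A w ∧ a ∉ A w := by
  by_contra! hcon
  simp only [count_sum_val, Multiset.countP_cons, ha, hb, if_true, if_false] at hab
  -- Within `U`, `b` is at most as frequent as `a`; since `u` counts for `a` only, `a` would be
  -- strictly more frequent overall.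
  have : U.countP (fun w => b ∈ A w) ≤ U.countP fun w => a ∈ A w := by
    rw [Multiset.countP_eq_card_filter,
      Multiset.filter_congr (q := fun w => a ∈ A w ∧ b ∈ A w)
        fun w hw => ⟨fun h => ⟨hcon w hw h, h⟩, fun h => h.2⟩, Multiset.countP_eq_card_filter]
    exact Multiset.card_le_card (Multiset.monotone_filter_right _ fun _ h => h.1)
  omega

/-- An exchange preserves the multiset sum, so it keeps the induction hypothesis valid and gives a
binomial in the kernel. -/
theorem val_insert_erase_add [DecidableEq τ] {s t : Finset τ} {a b : τ} (has : a ∈ s) (hbs : b ∉ s)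
    (hbt : b ∈ t) (hat : a ∉ t) :
    (insert b (s.erase a)).val + (insert a (t.erase b)).val = s.val + t.val := by
  have hab : a ≠ b := by rintro rfl; exact hbs has
  ext c
  simp only [Multiset.count_add, Multiset.count_eq_of_nodup (Finset.nodup _), Finset.mem_val,
    Finset.mem_insert, Finset.mem_erase]
  by_cases hca : c = a
  · subst hca; simp [*]
  by_cases hcb : c = b
  · subst hcb; simp [*]
  simp [hca, hcb]

/-- If products of two factors are invariant under exchanging elements of the associated `s`-element
sets, then products over two multisets agree whenever the sums of the associated sets do. -/
theorem prod_map_eq_of_sum_eq [DecidableEq τ] {A : ι → Finset τ} {g : ι → C} {s : ℕ}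
    (hcard : ∀ u, (A u).card = s) (hone : ∀ u, A u = ∅ → g u = 1)
    (hcongr : ∀ u v, A u = A v → g u = g v)
    (hexch : ∀ u v a b, a ∈ A u → b ∉ A u → b ∈ A v → a ∉ A v →
      ∃ u' v', A u' = insert b ((A u).erase a) ∧ A v' = insert a ((A v).erase b) ∧
        g u * g v = g u' * g v')
    (U V : Multiset ι)
    (h : (U.map fun u => (A u).val).sum = (V.map fun v => (A v).val).sum) :
    (U.map g).prod = (V.map g).prod := by
  induction hd : U.card generalizing U V with
  | zero =>
    obtain rfl := Multiset.card_eq_zero.1 hd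
    rw [Multiset.map_zero, Multiset.sum_zero] at h
    rw [prod_map_eq_one_of_sum_eq_zero hone h.symm]
    simp
  | succ d ihd =>
    obtain ⟨u, hu⟩ : ∃ u, u ∈ U := Multiset.card_pos_iff_exists_mem.1 (hd ▸ d.succ_pos)
    obtain ⟨U, rfl⟩ := Multiset.exists_cons_of_mem hu
    rcases V.empty_or_exists_mem with rfl | ⟨v, hv⟩
    · rw [prod_map_eq_one_of_sum_eq_zero hone h]
      simp
    obtain ⟨V, rfl⟩ := Multiset.exists_cons_of_mem hv
    clear hu hv
    -- Exchanges bring `A u` and `A v` together; once they coincide, both factors cancel and the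
    -- degree drops.
    induction hc : (A u \ A v).card using Nat.strong_induction_on generalizing u v U V with
    | _ c ihc =>
    have hsd : (A u \ A v).card = (A v \ A u).card :=
      Finset.card_sdiff_comm ((hcard u).trans (hcard v).symm)
    rcases (A u \ A v).eq_empty_or_nonempty with h0 | ⟨a, ha⟩
    · have huv : A u = A v := Finset.eq_of_subset_of_card_le (Finset.sdiff_eq_empty_iff_subset.1 h0)
        ((hcard v).trans (hcard u).symm).le
      simp only [Multiset.map_cons, Multiset.sum_cons, huv, add_right_inj] at h
      simp only [Multiset.map_cons, Multiset.prod_cons, hcongr u v huv]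
      rw [ihd U V h (by simpa using hd)]
    obtain ⟨b, hb⟩ : (A v \ A u).Nonempty :=
      Finset.card_pos.1 (hsd ▸ Finset.card_pos.2 ⟨a, ha⟩)
    have hlt : ((A u \ A v).erase a).card < c := hc ▸ Finset.card_erase_lt_of_mem ha
    rw [Finset.mem_sdiff] at ha hb
    -- The rarer of `a`, `b` decides the side: if `a`, some `w ∈ U` can trade `b` for the `a` of
    -- `u`; if `b`, the trade is made in `V`, which has the same counts.
    rcases le_total (((u ::ₘ U).map fun u => (A u).val).sum.count a)
        (((u ::ₘ U).map fun u => (A u).val).sum.count b) with hab | hab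
    · obtain ⟨w, hw, hbw, haw⟩ := exists_mem_exchange ha.1 hb.2 hab
      obtain ⟨U, rfl⟩ := Multiset.exists_cons_of_mem hw
      obtain ⟨u', w', hu', hw', hg⟩ := hexch u w a b ha.1 hb.2 hbw haw
      have hsum := val_insert_erase_add ha.1 hb.2 hbw haw
      rw [← hu', ← hw'] at hsum
      have hgU : ((u ::ₘ w ::ₘ U).map g).prod = ((u' ::ₘ w' ::ₘ U).map g).prod := by
        simp only [Multiset.map_cons, Multiset.prod_cons, ← mul_assoc, hg]
      rw [hgU]
      refine ihc _ hlt u' (w' ::ₘ U) ?_ v V ?_ ?_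
      · simpa using hd
      · rw [← h]
        simp only [Multiset.map_cons, Multiset.sum_cons, ← add_assoc, hsum]
      · rw [hu', Finset.insert_sdiff_of_mem _ hb.1, Finset.erase_sdiff_comm]
    · rw [h] at hab
      obtain ⟨w, hw, haw, hbw⟩ := exists_mem_exchange hb.1 ha.2 hab
      obtain ⟨V, rfl⟩ := Multiset.exists_cons_of_mem hw
      obtain ⟨v', w', hv', hw', hg⟩ := hexch v w b a hb.1 ha.2 haw hbw
      have hsum := val_insert_erase_add hb.1 ha.2 haw hbw
      rw [← hv', ← hw'] at hsum
      have hgV : ((v ::ₘ w ::ₘ V).map g).prod = ((v' ::ₘ w' ::ₘ V).map g).prod := by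
        simp only [Multiset.map_cons, Multiset.prod_cons, ← mul_assoc, hg]
      rw [hgV]
      refine ihc _ hlt u U hd v' (w' ::ₘ V) ?_ ?_
      · rw [h]
        simp only [Multiset.map_cons, Multiset.sum_cons, ← add_assoc, hsum]
      · congr 1
        ext c
        rw [hv']
        simp only [Finset.mem_sdiff, Finset.mem_insert, Finset.mem_erase]
        have : c = b → c ∉ A u := fun h => h ▸ hb.2
        tauto

end Exchange

/-! ### Kernels of monomial maps. -/

section MonomialMap

variable {K : Type*} [Field K]

/-- A linear map out of a polynomial ring that only depends on the images of monomials under a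
monomial map vanishes on the kernel of that monomial map. -/
theorem linearMap_eq_zero_of_monomial {ι τ M : Type*} [AddCommGroup M] [Module K M]
    (φ : MvPolynomial ι K →ₗ[K] MvPolynomial τ K) (ψ : (ι →₀ ℕ) → (τ →₀ ℕ))
    (hφ : ∀ e, φ (monomial e 1) = monomial (ψ e) 1) (q : MvPolynomial ι K →ₗ[K] M)
    (hq : ∀ e e', ψ e = ψ e' → q (monomial e 1) = q (monomial e' 1))
    {p : MvPolynomial ι K} (hp : φ p = 0) : q p = 0 := by
  -- `q` factors through `φ`; the value `0` outside the range of `ψ` is arbitrary.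
  let H : MvPolynomial τ K →ₗ[K] M := (basisMonomials τ K).constr K
    (Function.extend ψ (fun e => q (monomial e 1)) 0)
  have hH : H ∘ₗ φ = q := by
    refine (basisMonomials ι K).ext fun e => ?_
    rw [coe_basisMonomials, LinearMap.comp_apply, hφ,
      show monomial (ψ e) (1 : K) = basisMonomials τ K (ψ e) by rw [coe_basisMonomials],
      Module.Basis.constr_basis]
    exact Function.FactorsThrough.extend_apply (fun e e' h => hq e e' h) 0 e
  rw [← hH, LinearMap.comp_apply, hp, map_zero]

end MonomialMap

/-! ### The kernels `Q_n` and their symmetrizations. -/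

section Kernel

variable {K : Type*} [Field K] {k : ℕ}

theorem phi_rename_trans (f : MvPolynomial (Fin k) K) {n m : ℕ} (e : Fin n ↪ Fin m) (p : R K k n) :
    phi f m (rename (fun u : Fin k ↪ Fin n => u.trans e) p) = rename e (phi f n p) := by
  have : (phi f m).comp (rename fun u : Fin k ↪ Fin n => u.trans e) =
      (rename e).comp (phi f n) := by
    refine algHom_ext fun u => ?_
    simp only [phi, AlgHom.comp_apply, rename_X, aeval_X]
    rw [← AlgHom.comp_apply, comp_aeval]
    simp
  exact DFunLike.congr_fun this p

theorem perm_incl {n m : ℕ} (h : n ≤ m) (σ : Equiv.Perm (Fin m)) (p : R K k n) :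
    perm σ (incl h p) =
      rename (fun u : Fin k ↪ Fin n => u.trans ((Fin.castLEEmb h).trans σ.toEmbedding)) p := by
  rw [perm, incl, rename_rename]
  rfl

theorem incl_mem_kernelIdeal (f : MvPolynomial (Fin k) K) {n m : ℕ} (h : n ≤ m) {g : R K k n}
    (hg : g ∈ kernelIdeal f n) : incl h g ∈ kernelIdeal f m := by
  rw [kernelIdeal, RingHom.mem_ker] at hg ⊢
  rw [incl, phi_rename_trans, hg, map_zero]

theorem symmetrization_kernelIdeal_le (f : MvPolynomial (Fin k) K) {n m : ℕ} (h : n ≤ m) :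
    symmetrization h (kernelIdeal f n : Set (R K k n)) ≤ kernelIdeal f m := by
  refine Ideal.span_le.2 ?_
  rintro _ ⟨σ, g, hg, rfl⟩
  rw [SetLike.mem_coe, kernelIdeal, RingHom.mem_ker] at hg ⊢
  rw [perm_incl, phi_rename_trans, hg, map_zero]

theorem isSymmetrizationInvariantChain_kernelIdeal (f : MvPolynomial (Fin k) K) :
    IsSymmetrizationInvariantChain (kernelIdeal f) where
  increasing _ _ _ h _ hg := incl_mem_kernelIdeal f h hg
  symmetrization_le _ _ _ h := symmetrization_kernelIdeal_le f h

/-- Every set of at most `n` elements of `Fin m` is moved into the first `n` elements by some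
permutation. -/
theorem exists_perm_lt {n m : ℕ} (h : n ≤ m) (T : Finset (Fin m)) (hT : T.card ≤ n) :
    ∃ σ : Equiv.Perm (Fin m), ∀ i ∈ T, ∃ j : Fin n, i = σ (Fin.castLE h j) := by
  obtain ⟨T', hTT', hT'⟩ := Finset.exists_superset_card_eq hT (by simpa using h)
  let S : Finset (Fin m) := Finset.univ.map (Fin.castLEEmb h)
  have hS : S.card = T'.card := by simp [S, hT']
  let e : {x // x ∈ S} ≃ {x // x ∈ T'} := Finset.equivOfCardEq hS
  refine ⟨e.extendSubtype, fun i hi => ?_⟩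
  obtain ⟨j, -, hj⟩ := Finset.mem_map.1 (e.symm ⟨i, hTT' hi⟩).2
  refine ⟨j, ?_⟩
  have hj' : Fin.castLE h j = e.symm ⟨i, hTT' hi⟩ := hj
  rw [hj', Equiv.extendSubtype_apply_of_mem _ _ (Subtype.prop _)]
  simp

/-- Elements of `Q_m` which involve at most `n` indices lie in `L_m(Q_n)`. -/
theorem mem_symmetrization_of_card_le (f : MvPolynomial (Fin k) K) {n m : ℕ} (h : n ≤ m)
    (T : Finset (Fin m)) (hT : T.card ≤ n) {p : R K k m} (hp : p ∈ kernelIdeal f m)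
    (hpT : ∀ u ∈ p.vars, ∀ i, u i ∈ T) :
    p ∈ symmetrization h (kernelIdeal f n : Set (R K k n)) := by
  obtain ⟨σ, hσ⟩ := exists_perm_lt h T hT
  let e : Fin n ↪ Fin m := (Fin.castLEEmb h).trans σ.toEmbedding
  have hinj : Function.Injective fun u : Fin k ↪ Fin n => u.trans e := fun u v huv => by
    ext i
    have := DFunLike.congr_fun huv i
    exact congrArg Fin.val (e.injective this)
  obtain ⟨q, rfl⟩ := (exists_rename_eq_of_vars_subset_range p _ hinj fun u hu => by
    choose j hj using fun i => hσ (u i) (hpT u hu i)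
    refine ⟨⟨j, fun a b hab => u.injective ?_⟩, ?_⟩
    · rw [hj, hj, hab]
    · ext i
      exact congrArg Fin.val (hj i).symm)
  rw [kernelIdeal, RingHom.mem_ker, phi_rename_trans] at hp
  refine Ideal.subset_span ⟨σ, q, ?_, (perm_incl h σ q).symm⟩
  rw [SetLike.mem_coe, kernelIdeal, RingHom.mem_ker]
  -- Injective renaming of the `t_i` reflects vanishing, so the preimage `q` is already in `Q_n`.
  exact rename_injective e e.injective (hp.trans (map_zero _).symm)

theorem IsSquarefreeMonomial.exists_finset {f : MvPolynomial (Fin k) K}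
    (hf : IsSquarefreeMonomial f) : ∃ S : Finset (Fin k), f = ∏ i ∈ S, X i := by
  obtain ⟨⟨a, rfl⟩, hsq⟩ := hf
  refine ⟨a.support, ?_⟩
  rw [monomial_eq, C_1, one_mul]
  refine Finset.prod_congr rfl fun i hi => ?_
  suffices a i = 1 by simp only [this, pow_one]
  by_contra hne
  have h2 : 2 ≤ a i := by
    have := Finsupp.mem_support_iff.1 hi
    omega
  have hdvd : (X i * X i : MvPolynomial (Fin k) K) ∣ monomial a 1 := by
    rw [X, monomial_mul, monomial_dvd_monomial]
    refine ⟨Or.inr fun j => ?_, by simp⟩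
    by_cases hj : i = j
    · subst hj; simpa using h2
    · simp [hj]
  have hu := hsq _ hdvd
  exact (X_prime (R := K) (i := i)).not_isUnit hu

theorem monomial_toFinsupp {τ : Type*} [DecidableEq τ] (U : Multiset τ) :
    monomial (Multiset.toFinsupp U) (1 : K) = (U.map X).prod := by
  induction U using Multiset.induction_on with
  | empty => simp
  | cons a U ih =>
    rw [Multiset.map_cons, Multiset.prod_cons, ← ih, ← Multiset.singleton_add, map_add,
      Multiset.toFinsupp_singleton, X, monomial_mul, one_mul]

theorem monomial_eq_prod_map_toMultiset {ι : Type*} (e : ι →₀ ℕ) :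
    monomial e (1 : K) = ((Finsupp.toMultiset e).map X).prod := by
  classical
  rw [← monomial_toFinsupp, Finsupp.toMultiset_toFinsupp]

theorem phi_prod_X (S : Finset (Fin k)) {m : ℕ} (u : Fin k ↪ Fin m) :
    phi (∏ i ∈ S, X i : MvPolynomial (Fin k) K) m (X u) = ((S.map u).val.map X).prod := by
  simp only [phi, aeval_X, map_prod]
  rw [Finset.prod_map_val, Finset.prod_map]

theorem phi_prod_map_X (S : Finset (Fin k)) {m : ℕ} (U : Multiset (Fin k ↪ Fin m)) :
    phi (∏ i ∈ S, X i : MvPolynomial (Fin k) K) m (U.map X).prod =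
      ((U.map fun u => (S.map u).val).sum.map X).prod := by
  induction U using Multiset.induction_on with
  | empty => simp
  | cons u U ih =>
    rw [Multiset.map_cons, Multiset.prod_cons, map_mul, ih, phi_prod_X, Multiset.map_cons,
      Multiset.sum_cons, Multiset.map_add, Multiset.prod_add]

theorem mem_symmetrization_of_vars_subset (f : MvPolynomial (Fin k) K) {n m : ℕ} (h : n ≤ m)
    (hn : 4 * k ≤ n) (W : Finset (Fin k ↪ Fin m)) (hW : W.card ≤ 4) {p : R K k m}
    (hp : p ∈ kernelIdeal f m) (hpW : p.vars ⊆ W) :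
    p ∈ symmetrization h (kernelIdeal f n : Set (R K k n)) := by
  refine mem_symmetrization_of_card_le f h (W.biUnion fun u => Finset.univ.map u) ?_ hp
    fun u hu i => Finset.mem_biUnion.2 ⟨u, hpW hu, Finset.mem_map_of_mem u (Finset.mem_univ i)⟩
  calc _ ≤ W.card * k := Finset.card_biUnion_le_card_mul _ _ _ fun u _ => by simp
    _ ≤ 4 * k := Nat.mul_le_mul_right k hW
    _ ≤ n := hn

/-- Products of residue classes of at most two indeterminates modulo `L_m(Q_n)` only depend on
their images under `φ_m`. -/
theorem prod_mk_eq_of_card_le_two (S : Finset (Fin k)) {n m : ℕ} (h : n ≤ m) (hn : 4 * k ≤ n)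
    (U V : Multiset (Fin k ↪ Fin m)) (hU : U.card ≤ 2) (hV : V.card ≤ 2)
    (hUV : (U.map fun u => (S.map u).val).sum = (V.map fun u => (S.map u).val).sum) :
    Ideal.Quotient.mk (symmetrization h
        (kernelIdeal (∏ i ∈ S, X i : MvPolynomial (Fin k) K) n : Set (R K k n))) (U.map X).prod =
      Ideal.Quotient.mk _ (V.map X).prod := by
  classical
  rw [Ideal.Quotient.mk_eq_mk_iff_sub_mem]
  refine mem_symmetrization_of_vars_subset _ h hn (U.toFinset ∪ V.toFinset) ?_ ?_ ?_
  · have h1 := Finset.card_union_le U.toFinset V.toFinset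
    have h2 := Multiset.toFinset_card_le U
    have h3 := Multiset.toFinset_card_le V
    omega
  · rw [kernelIdeal, RingHom.mem_ker, map_sub, phi_prod_map_X, phi_prod_map_X, hUV, sub_self]
  · have hvars : ∀ W : Multiset (Fin k ↪ Fin m),
        ((W.map X).prod : R K k m).vars ⊆ W.toFinset := fun W => by
      rw [← monomial_toFinsupp, vars_monomial one_ne_zero, Multiset.toFinsupp_support]
    exact (vars_sub_subset _).trans (Finset.union_subset_union (hvars U) (hvars V))

theorem map_trans_swap {τ : Type*} [DecidableEq τ] (S : Finset (Fin k)) (u : Fin k ↪ τ) {a b : τ}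
    (ha : a ∈ S.map u) (hb : b ∉ S.map u) :
    S.map (u.trans (Equiv.swap a b).toEmbedding) = insert b ((S.map u).erase a) := by
  rw [← Finset.map_map]
  ext c
  rw [Finset.mem_map_equiv, Equiv.symm_swap, Finset.mem_insert, Finset.mem_erase]
  rcases eq_or_ne c a with rfl | hca
  · have : c ≠ b := fun h => hb (h ▸ ha)
    simp [hb, this]
  rcases eq_or_ne c b with rfl | hcb
  · simp [ha]
  · simp [Equiv.swap_apply_of_ne_of_ne hca hcb, hca, hcb]

theorem kernelIdeal_le_symmetrization (S : Finset (Fin k)) {n m : ℕ} (h : n ≤ m)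
    (hn : 4 * k ≤ n) :
    kernelIdeal (∏ i ∈ S, X i : MvPolynomial (Fin k) K) m ≤
      symmetrization h
        (kernelIdeal (∏ i ∈ S, X i : MvPolynomial (Fin k) K) n : Set (R K k n)) := by
  intro p hp
  let q := Ideal.Quotient.mkₐ K (symmetrization h
    (kernelIdeal (∏ i ∈ S, X i : MvPolynomial (Fin k) K) n : Set (R K k n)))
  have hle := prod_mk_eq_of_card_le_two (K := K) S h hn
  have hprod : ∀ U V : Multiset (Fin k ↪ Fin m),
      (U.map fun u => (S.map u).val).sum = (V.map fun u => (S.map u).val).sum →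
      (U.map fun u => q (X u)).prod = (V.map fun u => q (X u)).prod := by
    refine prod_map_eq_of_sum_eq (s := S.card) (fun u => Finset.card_map u)
      (fun u hu => ?_) (fun u v huv => ?_) fun u v a b hau hbu hbv hav => ?_
    -- This matters only for `S = ∅`, where `x_u - 1` lies in the kernel.
    · simpa [q] using hle {u} 0 (by simp) (by simp) (by simpa using hu)
    · simpa [q] using hle {u} {v} (by simp) (by simp) (by
        simpa using congrArg Finset.val huv)
    · have hu := map_trans_swap S u hau hbu
      have hv := map_trans_swap S v hbv hav
      -- The exchanged sets are realized by composing both tuples with the transposition of `a` and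
      -- `b`.
      refine ⟨_, _, hu, hv, ?_⟩
      have := hle {u, v} {u.trans (Equiv.swap a b).toEmbedding,
        v.trans (Equiv.swap b a).toEmbedding} (by simp) (by simp) (by
          simp only [Multiset.insert_eq_cons, Multiset.map_cons, Multiset.map_singleton,
            Multiset.sum_cons, Multiset.sum_singleton, hu, hv]
          exact (val_insert_erase_add hau hbu hbv hav).symm)
      simpa [q] using this
  have hq : ∀ e, q (monomial e 1) = ((Finsupp.toMultiset e).map fun u => q (X u)).prod := by
    intro e
    rw [monomial_eq_prod_map_toMultiset, map_multiset_prod, Multiset.map_map]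
    rfl
  refine Ideal.Quotient.eq_zero_iff_mem.1 ?_
  refine linearMap_eq_zero_of_monomial (phi (∏ i ∈ S, X i) m).toLinearMap
    (fun e => Multiset.toFinsupp ((Finsupp.toMultiset e).map fun u => (S.map u).val).sum)
    (fun e => ?_) q.toLinearMap (fun e e' hee => ?_) hp
  · rw [AlgHom.toLinearMap_apply, monomial_eq_prod_map_toMultiset, phi_prod_map_X,
      monomial_toFinsupp]
  · rw [AlgHom.toLinearMap_apply, AlgHom.toLinearMap_apply, hq, hq]
    exact hprod _ _ (Multiset.toFinsupp.injective hee)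

theorem stabilizesWithBound_kernelIdeal (hk : 1 ≤ k) (f : MvPolynomial (Fin k) K)
    (hf : IsSquarefreeMonomial f) : StabilizesWithBound (kernelIdeal f) (4 * k) where
  chain := isSymmetrizationInvariantChain_kernelIdeal f
  pos := by omega
  eq n m _ hn h := by
    obtain ⟨S, rfl⟩ := hf.exists_finset
    exact le_antisymm (symmetrization_kernelIdeal_le _ h)
      (kernelIdeal_le_symmetrization S h hn.le)

end Kernel

end SymChain

theorem mainTheorem8 {K : Type*} [Field K] {k : ℕ} (hk : 1 ≤ k)
    (f : MvPolynomial (Fin k) K) (hf : SymChain.IsSquarefreeMonomial f) :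
    SymChain.Stabilizes (SymChain.kernelIdeal f) ∧
      SymChain.StabilizesWithBound (SymChain.kernelIdeal f) (4 * k) :=
  ⟨⟨4 * k, SymChain.stabilizesWithBound_kernelIdeal hk f hf⟩,
    SymChain.stabilizesWithBound_kernelIdeal hk f hf⟩
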